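/- A Young diagram is a finite left-justified array of cells with weakly decreasing row lengths, all rows and columns being non-empty. A \emph{tree-like tableau} is a Young diagram some of whose cells contain a point, such that: (1) the top left cell contains a point, called the root point; (2) for every non-root pointed cell $c$, there is either a pointed cell above $c$ in the same column or a pointed cell to the left of $c$ in the same row, but not both; (3) every row and every column contains at least one pointed cell. Its \emph{size} is its number of points; $\mathcal{T}_n$ denotes the (finite) set of tree-like tableaux of size $n$. A \emph{corner} is a cell whose bottom edge and right edge both lie on the southeast border of the diagram, and a corner is \emph{non-occupied} if it contains no point. For $T\in\mathcal{T}_n$ let $noc(T)$ be the number of non-occupied corners of $T$. Then $$\sum_{T\in\mathcal{T}_n} noc(T)=\begin{cases} n!\cdot\dfrac{n-2}{6}, & n\geq 3,\\[1ex] 0, & n=1,2.\end{cases}$$ -/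

import Mathlib

/-- A tree-like tableau: a Young diagram some of whose cells contain a point. Cells are pairs
`(i, j)` with `i` the row (numbered downwards from `0`) and `j` the column (numbered rightwards
from `0`). -/
@[ext]
structure TreeLikeTableau where
  /-- The underlying diagram. It has no empty row and no empty column: its rows are the `i` with
  `(i, 0) ∈ shape`, its columns the `j` with `(0, j) ∈ shape`. -/
  shape : YoungDiagram
  /-- The pointed cells. -/
  points : Finset (ℕ × ℕ)
  points_subset : points ⊆ shape.cells
  /-- The top left cell contains a point, the root point. -/
  root_mem : ((0, 0) : ℕ × ℕ) ∈ points
  /-- A non-root pointed cell has a pointed cell above it in the same column, or a pointed cell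
  to its left in the same row, but not both. -/
  parent : ∀ i j : ℕ, (i, j) ∈ points → (i, j) ≠ (0, 0) →
    Xor (∃ i' < i, (i', j) ∈ points) (∃ j' < j, (i, j') ∈ points)
  /-- Every row possesses at least one pointed cell. -/
  row_pointed : ∀ i : ℕ, (i, 0) ∈ shape → ∃ j, (i, j) ∈ points
  /-- Every column possesses at least one pointed cell. -/
  col_pointed : ∀ j : ℕ, (0, j) ∈ shape → ∃ i, (i, j) ∈ points

/-- A cell of a Young diagram is a corner if its right edge and its bottom edge both lie on the
southeast border, that is, the diagram has no cell directly to its right and no cell directly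
below it. -/
def YoungDiagram.IsCorner (μ : YoungDiagram) (c : ℕ × ℕ) : Prop :=
  c ∈ μ ∧ (c.1, c.2 + 1) ∉ μ ∧ (c.1 + 1, c.2) ∉ μ

instance (μ : YoungDiagram) : DecidablePred μ.IsCorner := fun c =>
  inferInstanceAs (Decidable (c ∈ μ ∧ (c.1, c.2 + 1) ∉ μ ∧ (c.1 + 1, c.2) ∉ μ))

namespace TreeLikeTableau

/-- The size of a tree-like tableau is its number of points. -/
def size (T : TreeLikeTableau) : ℕ := T.points.card

/-- The set of non-occupied corners of `T`: the corners of the underlying diagram that contain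
no point. -/
def nonOccupiedCorners (T : TreeLikeTableau) : Finset (ℕ × ℕ) :=
  {c ∈ T.shape.cells | T.shape.IsCorner c ∧ c ∉ T.points}

/-- The number of non-occupied corners of `T`. -/
def noc (T : TreeLikeTableau) : ℕ := T.nonOccupiedCorners.card

theorem shape_subset (T : TreeLikeTableau) :
    T.shape.cells ⊆ Finset.range T.size ×ˢ Finset.range T.size := by
  rintro ⟨i, j⟩ h
  have h1 : Finset.range (i + 1) ⊆ T.points.image Prod.fst := by
    intro k hk
    have hk' : k ≤ i := Nat.lt_succ_iff.mp (Finset.mem_range.mp hk)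
    obtain ⟨l, hl⟩ := T.row_pointed k (T.shape.up_left_mem hk' (Nat.zero_le j) h)
    exact Finset.mem_image.mpr ⟨_, hl, rfl⟩
  have h2 : Finset.range (j + 1) ⊆ T.points.image Prod.snd := by
    intro k hk
    have hk' : k ≤ j := Nat.lt_succ_iff.mp (Finset.mem_range.mp hk)
    obtain ⟨l, hl⟩ := T.col_pointed k (T.shape.up_left_mem (Nat.zero_le i) hk' h)
    exact Finset.mem_image.mpr ⟨_, hl, rfl⟩
  have h3 := (Finset.card_le_card h1).trans Finset.card_image_le
  have h4 := (Finset.card_le_card h2).trans Finset.card_image_le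
  rw [Finset.card_range] at h3 h4
  exact Finset.mem_product.mpr ⟨Finset.mem_range.mpr h3, Finset.mem_range.mpr h4⟩

/-- There are finitely many tree-like tableaux of a given size. -/
theorem finite_setOf_size_eq (n : ℕ) : {T : TreeLikeTableau | T.size = n}.Finite := by
  let B : Finset (Finset (ℕ × ℕ)) := (Finset.range n ×ˢ Finset.range n).powerset
  refine Set.Finite.of_finite_image (f := fun T => (T.shape.cells, T.points))
    ((B ×ˢ B).finite_toSet.subset ?_) ?_
  · rintro _ ⟨T, rfl, rfl⟩
    have h := T.shape_subset
    simp only [B, Finset.coe_product, Set.mem_prod, Finset.mem_coe, Finset.mem_powerset]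
    exact ⟨h, T.points_subset.trans h⟩
  · intro T _ T' _ h
    exact TreeLikeTableau.ext (YoungDiagram.ext (Prod.ext_iff.mp h).1) (Prod.ext_iff.mp h).2

/-- The set of all tree-like tableaux of size `n`. -/
noncomputable def ofSize (n : ℕ) : Finset TreeLikeTableau :=
  (finite_setOf_size_eq n).toFinset

theorem mem_ofSize {n : ℕ} {T : TreeLikeTableau} : T ∈ ofSize n ↔ T.size = n := by
  simp [ofSize]

end TreeLikeTableau

/-! Encode a diagram by its border word, read from top right to bottom left, with `true` for a
vertical and `false` for a horizontal step. Let F(w) be the number of fillings of the diagram of w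
by the tree-like rules. A filling has rows + columns - 1 points, so size n means word length n + 1.

A corner is a factor `true false`, and deleting its cell turns the factor into `false true`. Hence
pairs (tableau, non-occupied corner) correspond to fillings of words u `false true` v, and the
required sum is the sum of F over all such factorizations (`TreeLikeTableau.sum_noc`).

At a corner other than the root cell, a filling either leaves it empty, or has a point there whose
parent is above (then it is alone in its row, and the row can be deleted), or to the left (then the
column can be deleted). This gives F(u t f v) = F(u f t v) + F(u f v) + F(u t v)
(`card_wordFillings`), the relation yx = xy + x + y of PASEP type. Words starting with `false` or
ending in `true` have an empty column or row, so F vanishes there. Therefore G(w) = F(t w f)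
satisfies the same relation, ignores an initial `false` and a final `true`, and has G([]) = 1.

With s = x + y, the relation gives y s^b = s^b (y + b) and x s^b = s^b (x - b), from which the sum
of G(u f t v) over |u| = a, |v| = b equals (a+1)(b+1)(a+b+1)! (`apply_add_pow_mul`,
`sum_words_append`). Summing over a + b = n - 3 gives the formula. -/

section OperatorAlgebra

/-! ### Operators satisfying yx = xy + x + y -/

variable {V : Type*} [AddCommGroup V] [Module ℚ V] {x y : Module.End ℚ V}

/-- The hypothesis says y s = s (y + 1) for s = x + y, so each factor s that y crosses adds 1. -/
theorem mul_add_pow_of_mul_eq (h : y * x = x * y + x + y) (b : ℕ) :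
    y * (x + y) ^ b = (x + y) ^ b * (y + (b : Module.End ℚ V)) := by
  induction b with
  | zero => simp
  | succ b ih =>
    have h1 : (y + (b : Module.End ℚ V)) * (x + y) = (x + y) * (y + ((b + 1 : ℕ) : Module.End ℚ V)) := by
      rw [add_mul, (Nat.cast_commute b (x + y)).eq]
      push_cast
      simp only [mul_add, add_mul, mul_one, h]
      abel
    rw [pow_succ, ← mul_assoc, ih, mul_assoc, h1, mul_assoc]

/-- Subtract the rule for y from the fact that x + y commutes with its own powers. -/
theorem mul_add_pow_of_mul_eq' (h : y * x = x * y + x + y) (b : ℕ) :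
    x * (x + y) ^ b + (x + y) ^ b * (b : Module.End ℚ V) = (x + y) ^ b * x := by
  have h1 := mul_add_pow_of_mul_eq h b
  have h2 : (x + y) * (x + y) ^ b = (x + y) ^ b * (x + y) := by rw [← pow_succ, pow_succ']
  rw [add_mul, h1, mul_add, mul_add] at h2
  have h3 := congrArg (fun z => z - (x + y) ^ b * y) h2
  simp only [add_sub_cancel_right] at h3
  rw [← h3]
  abel

variable {ε : V →ₗ[ℚ] ℚ} {g : V}

theorem apply_pow_mul (h : y * x = x * y + x + y) (hε : ∀ v, ε (x v) = ε v) (m : ℕ) :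
    ε (((x + y) ^ m * x) g) = (m + 1) * ε (((x + y) ^ m) g) := by
  rw [← mul_add_pow_of_mul_eq' h]
  simp [hε, ← nsmul_eq_mul']
  ring

/-- Splitting off the last factor, x contributes m + 1 times the previous value and y contributes it
once, so the ratio is m + 2. -/
theorem apply_add_pow (h : y * x = x * y + x + y) (hε : ∀ v, ε (x v) = ε v) (hg : y g = g)
    (h1 : ε g = 1) (m : ℕ) : ε (((x + y) ^ m) g) = (m + 1).factorial := by
  induction m with
  | zero => simp [h1]
  | succ m ih =>
    have h2 := apply_pow_mul (g := g) h hε m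
    rw [pow_succ, mul_add, LinearMap.add_apply, map_add, h2, Module.End.mul_apply, hg, ih,
      Nat.factorial_succ (m + 1)]
    push_cast
    ring

/-- Moving y to the right onto g gives the factor b + 1. Moving x to the right leaves x - b, where x
next to g counts a + b + 1, so the net factor is a + 1. -/
theorem apply_add_pow_mul (h : y * x = x * y + x + y) (hε : ∀ v, ε (x v) = ε v) (hg : y g = g)
    (h1 : ε g = 1) (a b : ℕ) :
    ε (((x + y) ^ a * (x * y) * (x + y) ^ b) g)
      = (a + 1) * (b + 1) * (a + b + 1).factorial := by
  have e1 : y (((x + y) ^ b) g) = ((b : ℚ) + 1) • ((x + y) ^ b) g := by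
    rw [← Module.End.mul_apply, mul_add_pow_of_mul_eq h]
    simp [mul_add, hg, ← nsmul_eq_mul', add_smul, Nat.cast_smul_eq_nsmul]
    abel
  have e2 : (x * (x + y) ^ b) = (x + y) ^ b * x - (x + y) ^ b * (b : Module.End ℚ V) :=
    eq_sub_of_add_eq (mul_add_pow_of_mul_eq' h b)
  have e3 : x (((x + y) ^ b) g) = ((x + y) ^ b * x) g - (b : ℚ) • ((x + y) ^ b) g := by
    rw [← Module.End.mul_apply, e2]
    simp [← nsmul_eq_mul', Nat.cast_smul_eq_nsmul]
  simp only [Module.End.mul_apply, e1, map_smul, e3, map_sub]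
  simp only [← Module.End.mul_apply, ← mul_assoc, ← pow_add]
  rw [apply_pow_mul h hε, apply_add_pow h hε hg h1]
  push_cast
  simp only [smul_eq_mul]
  ring

end OperatorAlgebra

/-! ### Words, and the operators acting on functions of words -/

/-- The words of length `n` in the two letters `true` and `false`. -/
noncomputable def words (n : ℕ) : Finset (List Bool) := (List.finite_length_eq Bool n).toFinset

theorem mem_words {n : ℕ} {w : List Bool} : w ∈ words n ↔ w.length = n := by simp [words]

theorem words_zero : words 0 = {[]} := by ext w; simp [mem_words]

theorem sum_words_succ {M : Type*} [AddCommMonoid M] (n : ℕ) (h : List Bool → M) :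
    ∑ w ∈ words (n + 1), h w = ∑ w ∈ words n, (h (false :: w) + h (true :: w)) := by
  classical
  have e : words (n + 1) = (words n).image (List.cons false) ∪ (words n).image (List.cons true) := by
    ext w
    rcases w with _ | ⟨_ | _, w⟩ <;> simp [mem_words]
  rw [e, Finset.sum_union, Finset.sum_image, Finset.sum_image, Finset.sum_add_distrib]
  · intro _ _ _ _ h; simpa using h
  · intro _ _ _ _ h; simpa using h
  · rw [Finset.disjoint_left]
    simp only [Finset.mem_image]
    rintro _ ⟨w, -, rfl⟩ ⟨w', -, h⟩
    simp at h

theorem sum_words_succ' {M : Type*} [AddCommMonoid M] (n : ℕ) (h : List Bool → M) :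
    ∑ w ∈ words (n + 1), h w = ∑ w ∈ words n, (h (w ++ [false]) + h (w ++ [true])) := by
  have e : ∀ (k : ℕ) (h : List Bool → M),
      ∑ w ∈ words k, h w = ∑ w ∈ words k, h w.reverse := fun k h =>
    Finset.sum_bij' (fun w _ => w.reverse) (fun w _ => w.reverse) (by simp [mem_words])
      (by simp [mem_words]) (by simp) (by simp) (by simp)
  rw [e, sum_words_succ, e n]
  simp

/-- The functions on words compatible with the commutation relation of the two letters and
invariant under removal of an initial `false`. -/
def compatibleFunctions : Submodule ℚ (List Bool → ℚ) where
  carrier := {h | (∀ u v, h (u ++ true :: false :: v) =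
      h (u ++ false :: true :: v) + h (u ++ false :: v) + h (u ++ true :: v)) ∧
    ∀ v, h (false :: v) = h v}
  add_mem' := by
    rintro a b ⟨ha, ha'⟩ ⟨hb, hb'⟩
    refine ⟨fun u v => ?_, fun v => ?_⟩
    · simp only [Pi.add_apply, ha, hb]; ring
    · simp only [Pi.add_apply, ha', hb']
  zero_mem' := by simp
  smul_mem' := by
    rintro c a ⟨ha, ha'⟩
    refine ⟨fun u v => ?_, fun v => ?_⟩
    · simp only [Pi.smul_apply, smul_eq_mul, ha]; ring
    · simp only [Pi.smul_apply, ha']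

/-- Appending a letter to the argument. -/
def appendLetter (l : Bool) : Module.End ℚ compatibleFunctions where
  toFun h := ⟨fun w => h.1 (w ++ [l]), by
    refine ⟨fun u v => ?_, fun v => ?_⟩
    · simpa using h.2.1 u (v ++ [l])
    · simpa using h.2.2 (v ++ [l])⟩
  map_add' _ _ := rfl
  map_smul' _ _ := rfl

theorem appendLetter_apply (l : Bool) (h : compatibleFunctions) (w : List Bool) :
    (appendLetter l h).1 w = h.1 (w ++ [l]) := rfl

theorem appendLetter_mul : appendLetter true * appendLetter false =
    appendLetter false * appendLetter true + appendLetter false + appendLetter true := by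
  ext h w
  simpa [appendLetter_apply] using h.2.1 w []

theorem appendLetter_pow_apply (n : ℕ) (h : compatibleFunctions) (w : List Bool) :
    (((appendLetter false + appendLetter true) ^ n) h).1 w = ∑ v ∈ words n, h.1 (w ++ v) := by
  induction n generalizing w with
  | zero => simp [words_zero]
  | succ n ih =>
    rw [pow_succ', sum_words_succ, Finset.sum_add_distrib]
    simp [appendLetter_apply, ih]

/-- Evaluation at the empty word. -/
def evalNil : compatibleFunctions →ₗ[ℚ] ℚ where
  toFun h := h.1 []
  map_add' _ _ := rfl
  map_smul' _ _ := rfl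

/-- G itself serves as the vector g: appending letters realizes x and y, powers of x + y sum over
all words of a given length, and evaluation at the empty word is ε. -/
theorem sum_words_append {G : List Bool → ℚ} (h0 : G [] = 1)
    (h : ∀ u v, G (u ++ true :: false :: v) =
      G (u ++ false :: true :: v) + G (u ++ false :: v) + G (u ++ true :: v))
    (hl : ∀ v, G (false :: v) = G v) (hr : ∀ v, G (v ++ [true]) = G v) (a b : ℕ) :
    ∑ u ∈ words a, ∑ v ∈ words b, G (u ++ false :: true :: v) =
      (a + 1) * (b + 1) * (a + b + 1).factorial := by
  let g : compatibleFunctions := ⟨G, h, hl⟩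
  rw [← apply_add_pow_mul (g := g) (ε := evalNil) appendLetter_mul (fun v => v.2.2 [])
    (Subtype.ext (funext hr)) h0 a b]
  simp only [Module.End.mul_apply]
  change _ = (((appendLetter false + appendLetter true) ^ a) _).1 []
  simp [appendLetter_pow_apply, appendLetter_apply, g]

theorem sum_antidiagonal_succ_mul_succ (m : ℕ) :
    ∑ p ∈ Finset.HasAntidiagonal.antidiagonal m, ((p.1 : ℚ) + 1) * (p.2 + 1) = (m + 1) * (m + 2) * (m + 3) / 6 := by
  have e : ∀ (c : ℚ) (k : ℕ), ∑ i ∈ Finset.range k, ((i : ℚ) + 1) * (c - i) =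
      c * (k * (k + 1) / 2) - (k - 1) * k * (k + 1) / 3 := by
    intro c k
    induction k with
    | zero => simp
    | succ k ih => rw [Finset.sum_range_succ, ih]; push_cast; ring
  rw [Finset.Nat.sum_antidiagonal_eq_sum_range_succ_mk]
  have e2 : ∑ i ∈ Finset.range (m + 1), ((i : ℚ) + 1) * (((m - i : ℕ) : ℚ) + 1) =
      ∑ i ∈ Finset.range (m + 1), ((i : ℚ) + 1) * (((m : ℚ) + 1) - i) := by
    refine Finset.sum_congr rfl fun i hi => ?_
    rw [Nat.cast_sub (Nat.lt_succ_iff.mp (Finset.mem_range.mp hi))]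
    ring
  exact e2.trans ((e _ _).trans (by push_cast; ring))

/-! ### Young diagrams as border words -/

/-- Membership of the cell `(i, j)` in the diagram whose border, read from the top right to the
bottom left, has a vertical step for each `true` and a horizontal step for each `false`. -/
def BorderCell : List Bool → ℕ → ℕ → Prop
  | [], _, _ => False
  | false :: w, i, j => BorderCell w i j
  | true :: w, 0, j => j < w.count false
  | true :: w, i + 1, j => BorderCell w i j

/-- The increasing enumeration of the natural numbers different from `k`. -/
def skip (k i : ℕ) : ℕ := if i < k then i else i + 1

theorem skip_strictMono (k : ℕ) : StrictMono (skip k) := by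
  intro i j h
  unfold skip
  grind

theorem image_skip_range {k n : ℕ} (h : k ≤ n) :
    (Finset.range n).image (skip k) = (Finset.range (n + 1)).erase k := by
  ext i
  simp only [Finset.mem_image, Finset.mem_range, Finset.mem_erase, skip]
  constructor
  · rintro ⟨a, ha, rfl⟩
    grind
  · rintro ⟨h1, h2⟩
    by_cases h3 : i < k
    · exact ⟨i, by omega, by simp [h3]⟩
    · exact ⟨i - 1, by omega, by grind⟩

namespace BorderCell

theorem lt_count_false {w : List Bool} {i j : ℕ} (h : BorderCell w i j) : j < w.count false := by
  induction w generalizing i with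
  | nil => exact h.elim
  | cons l w ih =>
    cases l
    · have := ih h
      simp only [List.count_cons_self]
      omega
    · cases i
      · simpa [BorderCell] using h
      · simpa using ih h

theorem lt_count_true {w : List Bool} {i j : ℕ} (h : BorderCell w i j) : i < w.count true := by
  induction w generalizing i with
  | nil => exact h.elim
  | cons l w ih =>
    cases l
    · simpa using ih h
    · cases i
      · simp
      · simpa using ih h

theorem mono {w : List Bool} {i j i' j' : ℕ} (h : BorderCell w i j) (hi : i' ≤ i) (hj : j' ≤ j) :
    BorderCell w i' j' := by
  induction w generalizing i i' with
  | nil => exact h.elim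
  | cons l w ih =>
    cases l
    · exact ih h hi
    · cases i with
      | zero =>
        obtain rfl : i' = 0 := by omega
        exact lt_of_le_of_lt hj h
      | succ i =>
        cases i' with
        | zero => exact lt_of_le_of_lt hj (lt_count_false (w := w) h)
        | succ i' => exact ih h (by omega)

end BorderCell

theorem not_borderCell_append_true (u : List Bool) (j : ℕ) :
    ¬ BorderCell (u ++ [true]) (u.count true) j := by
  induction u with
  | nil => simp [BorderCell]
  | cons l u ih => cases l <;> simpa [BorderCell] using ih

theorem borderCell_corner_iff (u v : List Bool) (i j : ℕ) :
    BorderCell (u ++ false :: true :: v) i j ↔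
      BorderCell (u ++ true :: false :: v) i j ∧ (i, j) ≠ (u.count true, v.count false) := by
  induction u generalizing i with
  | nil =>
    cases i with
    | zero => simp [BorderCell]; omega
    | succ i => simp [BorderCell]
  | cons l u ih =>
    cases l
    · simpa [BorderCell] using ih i
    · cases i with
      | zero => simp [BorderCell]
      | succ i => simpa [BorderCell] using ih i

theorem borderCell_corner (u v : List Bool) :
    BorderCell (u ++ true :: false :: v) (u.count true) (v.count false) := by
  induction u with
  | nil => simp [BorderCell]
  | cons l u ih => cases l <;> simpa [BorderCell] using ih

theorem le_of_borderCell_corner_row {u v : List Bool} {j : ℕ}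
    (h : BorderCell (u ++ true :: false :: v) (u.count true) j) : j ≤ v.count false := by
  induction u with
  | nil => simpa [BorderCell, Nat.lt_succ_iff] using h
  | cons l u ih => cases l <;> exact ih (by simpa [BorderCell] using h)

theorem le_of_borderCell_corner_col {u v : List Bool} {i : ℕ}
    (h : BorderCell (u ++ true :: false :: v) i (v.count false)) : i ≤ u.count true := by
  induction u generalizing i with
  | nil =>
    cases i with
    | zero => simp
    | succ i =>
      have := BorderCell.lt_count_false (w := v) (i := i) h
      omega
  | cons l u ih =>
    cases l
    · simpa using ih (by simpa [BorderCell] using h)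
    · cases i with
      | zero => simp
      | succ i => simpa using ih (by simpa [BorderCell] using h)

/-- Dropping the vertical step of a corner deletes the corner's row; `skip` renumbers the remaining
rows. -/
theorem borderCell_skip_row (u v : List Bool) (i j : ℕ) :
    BorderCell (u ++ false :: v) i j ↔
      BorderCell (u ++ true :: false :: v) (skip (u.count true) i) j := by
  induction u generalizing i with
  | nil => simp [BorderCell, skip]
  | cons l u ih =>
    cases l
    · simpa [BorderCell] using ih i
    · cases i with
      | zero => simp [BorderCell, skip]
      | succ i =>
        have e : skip ((true :: u).count true) (i + 1) = skip (u.count true) i + 1 := by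
          simp [skip]; split <;> rfl
        rw [e]
        exact ih i

theorem borderCell_skip_col (u v : List Bool) (i j : ℕ) :
    BorderCell (u ++ true :: v) i j ↔
      BorderCell (u ++ true :: false :: v) i (skip (v.count false) j) := by
  induction u generalizing i with
  | nil =>
    cases i with
    | zero => simp only [List.nil_append, BorderCell, skip, List.count_cons_self]; grind
    | succ i =>
      simp only [List.nil_append, BorderCell]
      by_cases h : j < v.count false
      · simp [skip, h]
      · simp only [skip, h, if_false]
        constructor <;> intro h' <;> have := h'.lt_count_false <;> omega
  | cons l u ih =>
    cases l
    · simpa [BorderCell] using ih i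
    · cases i with
      | zero =>
        simp only [List.cons_append, BorderCell, skip, List.count_append, ne_eq,
          reduceCtorEq, not_false_eq_true, List.count_cons_of_ne, List.count_cons_self]
        grind
      | succ i => simpa [BorderCell] using ih i

/-- The letter counts are needed because initial `false`s and final `true`s bound no cell. -/
theorem eq_of_borderCell_iff {w w' : List Bool} (ht : w.count true = w'.count true)
    (hf : w.count false = w'.count false) (h : ∀ i j, BorderCell w i j ↔ BorderCell w' i j) :
    w = w' := by
  induction w generalizing w' with
  | nil =>
    rcases w' with _ | ⟨_ | _, w'⟩
    · rfl
    · simp at hf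
    · simp at ht
  | cons l w ih =>
    rcases l with _ | _ <;> rcases w' with _ | ⟨_ | _, w'⟩
    · simp at hf
    · exact congrArg (List.cons false) (ih (by simpa using ht) (by simpa using hf) h)
    · exfalso
      have h1 : BorderCell (true :: w') 0 (w.count false) := by
        simp only [BorderCell]; simp at hf; omega
      exact lt_irrefl _ (((h _ _).2 h1).lt_count_false (w := w))
    · simp at ht
    · exfalso
      have h1 : BorderCell (true :: w) 0 (w'.count false) := by
        simp only [BorderCell]; simp at hf; omega
      exact lt_irrefl _ (((h _ _).1 h1).lt_count_false (w := w'))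
    · exact congrArg (List.cons true)
        (ih (by simpa using ht) (by simpa using hf) fun i j => h (i + 1) j)

theorem exists_border (r c : ℕ) (f : ℕ → ℕ) (hf : Antitone f) (hc : f 0 ≤ c)
    (hr : ∀ i, r ≤ i → f i = 0) :
    ∃ w : List Bool, w.count true = r ∧ w.count false = c ∧ ∀ i j, BorderCell w i j ↔ j < f i := by
  have pad : ∀ k w i j, BorderCell (List.replicate k false ++ w) i j ↔ BorderCell w i j := by
    intro k w i j
    induction k with
    | zero => rfl
    | succ k ih => exact ih
  induction r generalizing c f with
  | zero =>
    refine ⟨List.replicate c false, by simp [List.count_replicate], by simp, fun i j => ?_⟩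
    have := pad c [] i j
    rw [List.append_nil] at this
    rw [this, hr i (Nat.zero_le i)]
    simp [BorderCell]
  | succ r ih =>
    obtain ⟨w, h1, h2, h3⟩ := ih (f 0) (fun i => f (i + 1)) (fun a b h => hf (by omega))
      (hf (Nat.zero_le 1)) fun i hi => hr _ (by omega)
    -- The columns beyond the first row's length are empty; they are the horizontal steps before the
    -- first vertical one.
    refine ⟨List.replicate (c - f 0) false ++ true :: w, ?_, ?_, fun i j => ?_⟩
    · simp [List.count_replicate, h1]
    · simp [h2, hc]
    · rw [pad]
      cases i with
      | zero => simp [BorderCell, h2]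
      | succ i => exact h3 i j

theorem exists_factor_of_corner {w : List Bool} {i j : ℕ} (h : BorderCell w i j)
    (hr : ¬ BorderCell w i (j + 1)) (hd : ¬ BorderCell w (i + 1) j) :
    ∃ u v, w = u ++ true :: false :: v ∧ i = u.count true ∧ j = v.count false := by
  induction w generalizing i with
  | nil => exact h.elim
  | cons l w ih =>
    cases l with
    | false =>
      obtain ⟨u, v, rfl, rfl, rfl⟩ := ih h hr hd
      exact ⟨false :: u, v, rfl, by simp, rfl⟩
    | true =>
      cases i with
      | succ i =>
        obtain ⟨u, v, rfl, rfl, rfl⟩ := ih h hr hd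
        exact ⟨true :: u, v, rfl, by simp, rfl⟩
      | zero =>
        simp only [BorderCell] at h hr hd
        rcases w with _ | ⟨_ | _, w⟩
        · simp at h
        · refine ⟨[], w, rfl, rfl, ?_⟩
          simp at h hr
          omega
        · simp only [BorderCell] at hd
          exact absurd (by simpa using h) hd

theorem not_borderCell_right (u v : List Bool) :
    ¬ BorderCell (u ++ true :: false :: v) (u.count true) (v.count false + 1) := fun h => by
  have := le_of_borderCell_corner_row h
  omega

theorem not_borderCell_below (u v : List Bool) :
    ¬ BorderCell (u ++ true :: false :: v) (u.count true + 1) (v.count false) := fun h => by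
  have := le_of_borderCell_corner_col h
  omega

/-- Each `true` is the border step of one row, so the row of a corner locates its factor in the
word. -/
theorem factor_unique {u v u' v' : List Bool}
    (h : u ++ true :: false :: v = u' ++ true :: false :: v')
    (hc : u.count true = u'.count true) : u = u' ∧ v = v' := by
  induction u generalizing u' with
  | nil =>
    rcases u' with _ | ⟨_ | _, u'⟩
    · simpa using h
    · simp at h
    · simp at hc
  | cons l u ih =>
    rcases u' with _ | ⟨l', u'⟩
    · rcases l with _ | _
      · simp at h
      · simp at hc
    · simp only [List.cons_append, List.cons.injEq] at h
      obtain ⟨rfl, h⟩ := h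
      have hc' : u.count true = u'.count true := by
        cases l <;> simpa using hc
      obtain ⟨rfl, rfl⟩ := ih h hc'
      exact ⟨rfl, rfl⟩

/-! ### Fillings on arbitrary sets of rows and columns -/

/-- `P` is a filling of the cells `(i, j)`, `i ∈ B`, `j ∈ A`, that satisfy `R`, subject to the
rules of tree-like tableaux with rows `B` and columns `A`. -/
structure IsFilling (B A : Finset ℕ) (R : ℕ → ℕ → Prop) (P : Finset (ℕ × ℕ)) : Prop where
  cell : ∀ i j, (i, j) ∈ P → i ∈ B ∧ j ∈ A ∧ R i j
  root : ((0, 0) : ℕ × ℕ) ∈ P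
  parent : ∀ i j, (i, j) ∈ P → (i, j) ≠ (0, 0) →
    Xor (∃ i' < i, (i', j) ∈ P) (∃ j' < j, (i, j') ∈ P)
  row : ∀ i ∈ B, ∃ j, (i, j) ∈ P
  col : ∀ j ∈ A, ∃ i, (i, j) ∈ P

open Classical in
/-- The finite set of all fillings. -/
noncomputable def fillings (B A : Finset ℕ) (R : ℕ → ℕ → Prop) : Finset (Finset (ℕ × ℕ)) :=
  {P ∈ (B ×ˢ A).powerset | IsFilling B A R P}

section Fillings

variable {B A : Finset ℕ} {R : ℕ → ℕ → Prop} {P : Finset (ℕ × ℕ)}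

theorem mem_fillings : P ∈ fillings B A R ↔ IsFilling B A R P := by
  simp only [fillings, Finset.mem_filter, Finset.mem_powerset, and_iff_right_iff_imp]
  rintro h ⟨i, j⟩ hij
  exact Finset.mem_product.mpr ⟨(h.cell i j hij).1, (h.cell i j hij).2.1⟩

/-- A non-root point with a point above it is the leftmost of its row, and one with none above it is
the topmost of its column. This matches the non-root points with the rows and columns other than the
zeroth. -/
theorem IsFilling.card_add_one (h : IsFilling B A R P) : P.card + 1 = B.card + A.card := by
  classical
  have hB : 0 ∈ B := (h.cell 0 0 h.root).1
  have hA : 0 ∈ A := (h.cell 0 0 h.root).2.1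
  let Q := P.erase (0, 0)
  have hQ : ∀ {i j}, (i, j) ∈ Q ↔ (i, j) ≠ (0, 0) ∧ (i, j) ∈ P := Finset.mem_erase
  have nboth : ∀ {i j}, (i, j) ∈ P → (i, j) ≠ (0, 0) → (∃ i' < i, (i', j) ∈ P) →
      ¬ ∃ j' < j, (i, j') ∈ P := by
    intro i j hij hne ha hl
    rcases h.parent i j hij hne with ⟨_, h5⟩ | ⟨_, h5⟩
    · exact h5 hl
    · exact h5 ha
  have e1 : (Q.filter fun c => ∃ i' < c.1, (i', c.2) ∈ P).card = (B.erase 0).card := by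
    refine Finset.card_bij (fun c _ => c.1) ?_ ?_ ?_
    · rintro ⟨i, j⟩ hc
      obtain ⟨h1, i', hi', -⟩ := Finset.mem_filter.mp hc
      exact Finset.mem_erase.mpr ⟨by simp at hi' ⊢; omega, (h.cell i j (hQ.1 h1).2).1⟩
    · rintro ⟨i, j⟩ hc ⟨i₂, j₂⟩ hc₂ (rfl : i = i₂)
      obtain ⟨h1, h2⟩ := Finset.mem_filter.mp hc
      obtain ⟨h3, h4⟩ := Finset.mem_filter.mp hc₂
      rw [hQ] at h1 h3
      rcases lt_trichotomy j j₂ with hj | rfl | hj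
      · exact (nboth h3.2 h3.1 h4 ⟨j, hj, h1.2⟩).elim
      · rfl
      · exact (nboth h1.2 h1.1 h2 ⟨j₂, hj, h3.2⟩).elim
    · intro i hi
      obtain ⟨hi0, hiB⟩ := Finset.mem_erase.mp hi
      have hex := h.row i hiB
      have hne : (i, Nat.find hex) ≠ (0, 0) := by simp [hi0]
      refine ⟨(i, Nat.find hex), Finset.mem_filter.mpr ⟨hQ.2 ⟨hne, Nat.find_spec hex⟩, ?_⟩, rfl⟩
      rcases h.parent _ _ (Nat.find_spec hex) hne with ⟨h5, _⟩ | ⟨⟨j', hj', h5⟩, _⟩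
      · exact h5
      · exact absurd h5 (Nat.find_min hex hj')
  have e2 : (Q.filter fun c => ¬ ∃ i' < c.1, (i', c.2) ∈ P).card = (A.erase 0).card := by
    refine Finset.card_bij (fun c _ => c.2) ?_ ?_ ?_
    · rintro ⟨i, j⟩ hc
      obtain ⟨h1, h2⟩ := Finset.mem_filter.mp hc
      rw [hQ] at h1
      rcases h.parent _ _ h1.2 h1.1 with ⟨h5, _⟩ | ⟨⟨j', hj', h5⟩, _⟩
      · exact absurd h5 h2
      · exact Finset.mem_erase.mpr ⟨by simp; omega, (h.cell i j h1.2).2.1⟩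
    · rintro ⟨i, j⟩ hc ⟨i₂, j₂⟩ hc₂ (rfl : j = j₂)
      obtain ⟨h1, h2⟩ := Finset.mem_filter.mp hc
      obtain ⟨h3, h4⟩ := Finset.mem_filter.mp hc₂
      rw [hQ] at h1 h3
      rcases lt_trichotomy i i₂ with hj | rfl | hj
      · exact absurd ⟨i, hj, h1.2⟩ h4
      · rfl
      · exact absurd ⟨i₂, hj, h3.2⟩ h2
    · intro j hj
      obtain ⟨hj0, hjA⟩ := Finset.mem_erase.mp hj
      have hex := h.col j hjA
      have hne : (Nat.find hex, j) ≠ (0, 0) := by simp [hj0]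
      refine ⟨(Nat.find hex, j), Finset.mem_filter.mpr ⟨hQ.2 ⟨hne, Nat.find_spec hex⟩, ?_⟩, rfl⟩
      rintro ⟨i', hi', h5⟩
      exact Nat.find_min hex hi' h5
  have e3 := Finset.card_filter_add_card_filter_not (s := Q) fun c => ∃ i' < c.1, (i', c.2) ∈ P
  rw [e1, e2, Finset.card_erase_of_mem hB, Finset.card_erase_of_mem hA,
    Finset.card_erase_of_mem h.root] at e3
  have := Finset.card_pos.mpr ⟨_, hB⟩
  have := Finset.card_pos.mpr ⟨_, hA⟩
  have := Finset.card_pos.mpr ⟨_, h.root⟩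
  omega

theorem IsFilling.congr {R' : ℕ → ℕ → Prop} (h : IsFilling B A R P)
    (hR : ∀ i j, (i, j) ∈ P → R' i j) : IsFilling B A R' P :=
  ⟨fun i j hij => ⟨(h.cell i j hij).1, (h.cell i j hij).2.1, hR i j hij⟩, h.root, h.parent,
    h.row, h.col⟩

/-- Fillings are transported by increasing relabellings of rows and columns. -/
theorem card_fillings_image {f g : ℕ → ℕ} (hf : StrictMono f) (hg : StrictMono g) (hf0 : f 0 = 0)
    (hg0 : g 0 = 0) {R' : ℕ → ℕ → Prop} (hR : ∀ i j, R' i j ↔ R (f i) (g j)) :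
    (fillings (B.image f) (A.image g) R).card = (fillings B A R').card := by
  classical
  let e : ℕ × ℕ ↪ ℕ × ℕ := ⟨Prod.map f g, hf.injective.prodMap hg.injective⟩
  have mem : ∀ (P : Finset (ℕ × ℕ)) i j, (f i, g j) ∈ P.map e ↔ (i, j) ∈ P := fun P i j =>
    Finset.mem_map' e (a := (i, j))
  have mem' : ∀ (P : Finset (ℕ × ℕ)) i j, (i, j) ∈ P.map e →
      ∃ i' j', i = f i' ∧ j = g j' ∧ (i', j') ∈ P := by
    intro P i j h
    obtain ⟨⟨i', j'⟩, h1, h2⟩ := Finset.mem_map.mp h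
    obtain ⟨rfl, rfl⟩ := Prod.ext_iff.mp h2
    exact ⟨i', j', rfl, rfl, h1⟩
  have above : ∀ (P : Finset (ℕ × ℕ)) i j,
      (∃ i' < f i, (i', g j) ∈ P.map e) ↔ ∃ i' < i, (i', j) ∈ P := by
    intro P i j
    constructor
    · rintro ⟨i', hi', h⟩
      obtain ⟨a, b, rfl, hb, hab⟩ := mem' P _ _ h
      obtain rfl := hg.injective hb
      exact ⟨a, hf.lt_iff_lt.mp hi', hab⟩
    · rintro ⟨i', hi', h⟩
      exact ⟨f i', hf hi', (mem P i' j).mpr h⟩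
  have left : ∀ (P : Finset (ℕ × ℕ)) i j,
      (∃ j' < g j, (f i, j') ∈ P.map e) ↔ ∃ j' < j, (i, j') ∈ P := by
    intro P i j
    constructor
    · rintro ⟨i', hi', h⟩
      obtain ⟨a, b, ha, rfl, hab⟩ := mem' P _ _ h
      obtain rfl := hf.injective ha
      exact ⟨b, hg.lt_iff_lt.mp hi', hab⟩
    · rintro ⟨i', hi', h⟩
      exact ⟨g i', hg hi', (mem P i i').mpr h⟩
  have root : ∀ i j, (f i, g j) = (0, 0) ↔ (i, j) = (0, 0) := by
    intro i j
    have h1 := hf.injective.eq_iff (a := i) (b := 0)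
    have h2 := hg.injective.eq_iff (a := j) (b := 0)
    rw [hf0] at h1
    rw [hg0] at h2
    rw [Prod.mk_inj, Prod.mk_inj, h1, h2]
  have key : ∀ P, IsFilling (B.image f) (A.image g) R (P.map e) ↔ IsFilling B A R' P := by
    intro P
    constructor
    · intro h
      refine ⟨fun i j hij => ?_, ?_, fun i j hij h0 => ?_, fun i hi => ?_, fun j hj => ?_⟩
      · have := h.cell _ _ ((mem P i j).mpr hij)
        rw [hf.injective.mem_finset_image, hg.injective.mem_finset_image] at this
        exact ⟨this.1, this.2.1, (hR i j).mpr this.2.2⟩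
      · rw [← mem, hf0, hg0]; exact h.root
      · rw [← above, ← left]
        exact h.parent _ _ ((mem P i j).mpr hij) (by rwa [ne_eq, root])
      · obtain ⟨j, hj⟩ := h.row _ (Finset.mem_image_of_mem f hi)
        obtain ⟨a, b, ha, rfl, hab⟩ := mem' P _ _ hj
        exact ⟨b, hf.injective ha ▸ hab⟩
      · obtain ⟨i, hi⟩ := h.col _ (Finset.mem_image_of_mem g hj)
        obtain ⟨a, b, rfl, hb, hab⟩ := mem' P _ _ hi
        exact ⟨a, hg.injective hb ▸ hab⟩
    · intro h
      refine ⟨fun i j hij => ?_, ?_, fun i j hij h0 => ?_, fun i hi => ?_, fun j hj => ?_⟩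
      · obtain ⟨a, b, rfl, rfl, hab⟩ := mem' P _ _ hij
        obtain ⟨h1, h2, h3⟩ := h.cell a b hab
        exact ⟨Finset.mem_image_of_mem f h1, Finset.mem_image_of_mem g h2, (hR a b).mp h3⟩
      · have := (mem P 0 0).mpr h.root
        rwa [hf0, hg0] at this
      · obtain ⟨a, b, rfl, rfl, hab⟩ := mem' P _ _ hij
        rw [above, left]
        exact h.parent _ _ hab (by rwa [ne_eq, ← root])
      · obtain ⟨a, ha, rfl⟩ := Finset.mem_image.mp hi
        obtain ⟨b, hb⟩ := h.row a ha
        exact ⟨g b, (mem P a b).mpr hb⟩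
      · obtain ⟨a, ha, rfl⟩ := Finset.mem_image.mp hj
        obtain ⟨b, hb⟩ := h.col a ha
        exact ⟨f b, (mem P b a).mpr hb⟩
  symm
  refine Finset.card_bij (fun P _ => P.map e) ?_ ?_ ?_
  · intro P hP
    rw [mem_fillings] at hP ⊢
    exact (key P).mpr hP
  · intro P _ P' _ h
    exact Finset.map_injective e h
  · intro Q hQ
    rw [mem_fillings] at hQ
    have hsub : Q ⊆ (B ×ˢ A).map e := by
      rintro ⟨i, j⟩ hij
      obtain ⟨h1, h2, -⟩ := hQ.cell i j hij
      obtain ⟨a, ha, rfl⟩ := Finset.mem_image.mp h1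
      obtain ⟨b, hb, rfl⟩ := Finset.mem_image.mp h2
      exact (mem _ a b).mpr (Finset.mk_mem_product ha hb)
    obtain ⟨P, -, rfl⟩ := Finset.subset_map_iff.mp hsub
    exact ⟨P, mem_fillings.mpr ((key P).mp hQ), rfl⟩

theorem fillings_eq_empty_of_row {i : ℕ} (hi : i ∈ B) (h : ∀ j, ¬ R i j) :
    fillings B A R = ∅ := by
  refine Finset.eq_empty_of_forall_notMem fun P hP => ?_
  rw [mem_fillings] at hP
  obtain ⟨j, hj⟩ := hP.row i hi
  exact h j (hP.cell i j hj).2.2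

theorem fillings_eq_empty_of_col {j : ℕ} (hj : j ∈ A) (h : ∀ i, ¬ R i j) :
    fillings B A R = ∅ := by
  refine Finset.eq_empty_of_forall_notMem fun P hP => ?_
  rw [mem_fillings] at hP
  obtain ⟨i, hi⟩ := hP.col j hj
  exact h i (hP.cell i j hi).2.2

/-! ### Classification of fillings at a corner -/

section Corner

variable {i₀ j₀ : ℕ}

theorem fillings_remove_corner :
    fillings B A (fun i j => R i j ∧ (i, j) ≠ (i₀, j₀)) =
      (fillings B A R).filter fun P => (i₀, j₀) ∉ P := by
  ext P
  rw [Finset.mem_filter, mem_fillings, mem_fillings]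
  constructor
  · intro h
    exact ⟨h.congr fun i j hij => (h.cell i j hij).2.2.1, fun h' => (h.cell _ _ h').2.2.2 rfl⟩
  · rintro ⟨h, h'⟩
    exact h.congr fun i j hij => ⟨(h.cell i j hij).2.2, by rintro h2; exact h' (h2 ▸ hij)⟩

/-- The point in the corner has its parent above, hence nothing to its left, so it is alone in its
row. Deleting that row leaves a filling, and reinserting the point inverts this. -/
theorem card_filter_corner_above (h0 : (i₀, j₀) ≠ (0, 0)) (hi : i₀ ∈ B) (hj : j₀ ∈ A)
    (hR : R i₀ j₀) (hrow : ∀ j ∈ A, R i₀ j → j ≤ j₀) (hcol : ∀ i ∈ B, R i j₀ → i ≤ i₀) :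
    ((fillings B A R).filter fun P => (i₀, j₀) ∈ P ∧ ∃ i < i₀, (i, j₀) ∈ P).card =
      (fillings (B.erase i₀) A R).card := by
  classical
  refine Finset.card_bij' (fun P _ => P.erase (i₀, j₀)) (fun P _ => insert (i₀, j₀) P) ?_ ?_ ?_ ?_
  · intro P hP
    rw [Finset.mem_filter, mem_fillings] at hP
    rw [mem_fillings]
    obtain ⟨h, hc, i₁, hi₁, hc₁⟩ := hP
    have nl : ¬ ∃ j' < j₀, (i₀, j') ∈ P := by
      rcases h.parent _ _ hc h0 with ⟨_, h5⟩ | ⟨_, h5⟩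
      · exact h5
      · exact absurd ⟨i₁, hi₁, hc₁⟩ h5
    have hrow' : ∀ j, (i₀, j) ∈ P → j = j₀ := by
      intro j hj'
      obtain ⟨-, h1, h2⟩ := h.cell _ _ hj'
      rcases lt_or_eq_of_le (hrow j h1 h2) with h3 | h3
      · exact absurd ⟨j, h3, hj'⟩ nl
      · exact h3
    have hcol' : ∀ i, (i, j₀) ∈ P → i ≤ i₀ := fun i hi' =>
      hcol i (h.cell _ _ hi').1 (h.cell _ _ hi').2.2
    refine ⟨fun i j hij => ?_, ?_, fun i j hij hne => ?_, fun i hi' => ?_, fun j hj' => ?_⟩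
    · obtain ⟨h1, h2⟩ := Finset.mem_erase.mp hij
      obtain ⟨h3, h4⟩ := h.cell i j h2
      refine ⟨Finset.mem_erase.mpr ⟨?_, h3⟩, h4⟩
      rintro rfl
      exact h1 (by rw [hrow' j h2])
    · exact Finset.mem_erase.mpr ⟨h0.symm, h.root⟩
    · obtain ⟨h1, h2⟩ := Finset.mem_erase.mp hij
      have ha : (∃ i' < i, (i', j) ∈ P.erase (i₀, j₀)) ↔ ∃ i' < i, (i', j) ∈ P := by
        refine exists_congr fun i' => and_congr_right fun hlt => ?_
        rw [Finset.mem_erase, and_iff_right_iff_imp]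
        rintro - h3
        obtain ⟨rfl, rfl⟩ := Prod.mk_inj.mp h3
        exact absurd (hcol' i h2) (by omega)
      have hl : (∃ j' < j, (i, j') ∈ P.erase (i₀, j₀)) ↔ ∃ j' < j, (i, j') ∈ P := by
        refine exists_congr fun j' => and_congr_right fun hlt => ?_
        rw [Finset.mem_erase, and_iff_right_iff_imp]
        rintro - h3
        obtain ⟨rfl, rfl⟩ := Prod.mk_inj.mp h3
        exact absurd (hrow' j h2) (by omega)
      rw [ha, hl]
      exact h.parent i j h2 hne
    · obtain ⟨h1, h2⟩ := Finset.mem_erase.mp hi'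
      obtain ⟨j, hj'⟩ := h.row i h2
      exact ⟨j, Finset.mem_erase.mpr ⟨by simp [h1], hj'⟩⟩
    -- The corner's column keeps the point above the corner.
    · by_cases hjj : j = j₀
      · subst hjj
        exact ⟨i₁, Finset.mem_erase.mpr ⟨by simp; omega, hc₁⟩⟩
      · obtain ⟨i, hi'⟩ := h.col j hj'
        exact ⟨i, Finset.mem_erase.mpr ⟨by simp [hjj], hi'⟩⟩
  · intro P hP
    rw [mem_fillings] at hP
    rw [Finset.mem_filter, mem_fillings]
    have hrow' : ∀ j, (i₀, j) ∉ P := fun j hj' =>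
      Finset.notMem_erase i₀ B (hP.cell _ _ hj').1
    have hcol' : ∀ i, (i, j₀) ∈ P → i < i₀ := fun i hi' => by
      obtain ⟨h1, -, h2⟩ := hP.cell _ _ hi'
      obtain ⟨h3, h4⟩ := Finset.mem_erase.mp h1
      exact lt_of_le_of_ne (hcol i h4 h2) h3
    -- The corner's column must still contain a point, necessarily above row i₀; it makes the
    -- reinserted point's parent lie above.
    obtain ⟨i₁, hc₁⟩ := hP.col j₀ hj
    have hi₁ := hcol' i₁ hc₁
    refine ⟨⟨fun i j hij => ?_, ?_, fun i j hij hne => ?_, fun i hi' => ?_, fun j hj' => ?_⟩,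
      Finset.mem_insert_self _ _, i₁, hi₁, Finset.mem_insert_of_mem hc₁⟩
    · rcases Finset.mem_insert.mp hij with h1 | h1
      · obtain ⟨rfl, rfl⟩ := Prod.mk_inj.mp h1
        exact ⟨hi, hj, hR⟩
      · obtain ⟨h2, h3⟩ := hP.cell i j h1
        exact ⟨(Finset.mem_erase.mp h2).2, h3⟩
    · exact Finset.mem_insert_of_mem hP.root
    · rcases Finset.mem_insert.mp hij with h1 | h1
      · obtain ⟨rfl, rfl⟩ := Prod.mk_inj.mp h1
        refine Or.inl ⟨⟨i₁, hi₁, Finset.mem_insert_of_mem hc₁⟩, ?_⟩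
        rintro ⟨j', hj', h2⟩
        rcases Finset.mem_insert.mp h2 with h3 | h3
        · simp at h3; omega
        · exact hrow' _ h3
      · have ha : (∃ i' < i, (i', j) ∈ insert (i₀, j₀) P) ↔ ∃ i' < i, (i', j) ∈ P := by
          refine exists_congr fun i' => and_congr_right fun hlt => ?_
          rw [Finset.mem_insert, or_iff_right_iff_imp]
          intro h3
          obtain ⟨rfl, rfl⟩ := Prod.mk_inj.mp h3
          exact absurd (hcol' i h1) (by omega)
        have hl : (∃ j' < j, (i, j') ∈ insert (i₀, j₀) P) ↔ ∃ j' < j, (i, j') ∈ P := by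
          refine exists_congr fun j' => and_congr_right fun hlt => ?_
          rw [Finset.mem_insert, or_iff_right_iff_imp]
          intro h3
          obtain ⟨rfl, rfl⟩ := Prod.mk_inj.mp h3
          exact absurd h1 (hrow' j)
        rw [ha, hl]
        exact hP.parent i j h1 hne
    · by_cases hii : i = i₀
      · exact ⟨j₀, by rw [hii]; exact Finset.mem_insert_self _ _⟩
      · obtain ⟨j, hj'⟩ := hP.row i (Finset.mem_erase.mpr ⟨hii, hi'⟩)
        exact ⟨j, Finset.mem_insert_of_mem hj'⟩
    · obtain ⟨i, hi'⟩ := hP.col j hj'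
      exact ⟨i, Finset.mem_insert_of_mem hi'⟩
  · intro P hP
    exact Finset.insert_erase (Finset.mem_filter.mp hP).2.1
  · intro P hP
    refine Finset.erase_insert fun h => ?_
    exact Finset.notMem_erase i₀ B ((mem_fillings.mp hP).cell _ _ h).1

theorem IsFilling.transpose (h : IsFilling B A R P) :
    IsFilling A B (fun j i => R i j) (P.map (Equiv.prodComm ℕ ℕ).toEmbedding) := by
  have mem : ∀ i j, (j, i) ∈ P.map (Equiv.prodComm ℕ ℕ).toEmbedding ↔ (i, j) ∈ P := fun i j =>
    Finset.mem_map' (Equiv.prodComm ℕ ℕ).toEmbedding (a := (i, j))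
  refine ⟨fun i j hij => ?_, (mem 0 0).mpr h.root, fun j i hij hne => ?_, fun i hi => ?_,
    fun i hi => ?_⟩
  · obtain ⟨h1, h2, h3⟩ := h.cell j i ((mem j i).mp hij)
    exact ⟨h2, h1, h3⟩
  · simp only [mem]
    exact (h.parent i j ((mem i j).mp hij) (by simpa [and_comm] using hne)).symm
  · simpa only [mem] using h.col i hi
  · simpa only [mem] using h.row i hi

theorem map_prodComm_map_prodComm (P : Finset (ℕ × ℕ)) :
    (P.map (Equiv.prodComm ℕ ℕ).toEmbedding).map (Equiv.prodComm ℕ ℕ).toEmbedding = P := by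
  ext ⟨i, j⟩
  simp

theorem card_filter_fillings_transpose (p : Finset (ℕ × ℕ) → Prop) [DecidablePred p]
    (q : Finset (ℕ × ℕ) → Prop) [DecidablePred q]
    (h : ∀ P, p P ↔ q (P.map (Equiv.prodComm ℕ ℕ).toEmbedding)) :
    ((fillings B A R).filter p).card = ((fillings A B fun j i => R i j).filter q).card := by
  refine Finset.card_bij' (fun P _ => P.map (Equiv.prodComm ℕ ℕ).toEmbedding)
    (fun P _ => P.map (Equiv.prodComm ℕ ℕ).toEmbedding) ?_ ?_
    (fun P _ => map_prodComm_map_prodComm P) (fun P _ => map_prodComm_map_prodComm P)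
  · intro P hP
    rw [Finset.mem_filter, mem_fillings] at hP ⊢
    exact ⟨hP.1.transpose, (h P).mp hP.2⟩
  · intro P hP
    rw [Finset.mem_filter, mem_fillings] at hP ⊢
    exact ⟨hP.1.transpose, by rw [h, map_prodComm_map_prodComm]; exact hP.2⟩

theorem card_filter_corner_left (h0 : (i₀, j₀) ≠ (0, 0)) (hi : i₀ ∈ B) (hj : j₀ ∈ A)
    (hR : R i₀ j₀) (hrow : ∀ j ∈ A, R i₀ j → j ≤ j₀) (hcol : ∀ i ∈ B, R i j₀ → i ≤ i₀) :
    ((fillings B A R).filter fun P => (i₀, j₀) ∈ P ∧ ∃ j < j₀, (i₀, j) ∈ P).card =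
      (fillings B (A.erase j₀) R).card := by
  classical
  have e := card_filter_corner_above (B := A) (A := B) (R := fun j i => R i j) (i₀ := j₀)
    (j₀ := i₀) (by simpa [and_comm] using h0) hj hi hR hcol hrow
  have e' := card_filter_fillings_transpose (B := B) (A := A.erase j₀) (R := R) (fun _ => True)
    (fun _ => True) (fun _ => Iff.rfl)
  rw [Finset.filter_true, Finset.filter_true] at e'
  rw [e', ← e]
  refine card_filter_fillings_transpose _ _ fun P => ?_
  simp

/-- The three kinds of fillings of a diagram with respect to a corner: those in which the corner is
not occupied, and those in which it is the last point of its column or of its row. -/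
theorem card_fillings_corner (h0 : (i₀, j₀) ≠ (0, 0)) (hi : i₀ ∈ B) (hj : j₀ ∈ A)
    (hR : R i₀ j₀) (hrow : ∀ j ∈ A, R i₀ j → j ≤ j₀) (hcol : ∀ i ∈ B, R i j₀ → i ≤ i₀) :
    (fillings B A R).card = (fillings B A fun i j => R i j ∧ (i, j) ≠ (i₀, j₀)).card +
      (fillings (B.erase i₀) A R).card + (fillings B (A.erase j₀) R).card := by
  classical
  rw [fillings_remove_corner, ← card_filter_corner_above h0 hi hj hR hrow hcol,
    ← card_filter_corner_left h0 hi hj hR hrow hcol,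
    ← Finset.card_filter_add_card_filter_not (s := fillings B A R) fun P => (i₀, j₀) ∈ P,
    ← Finset.card_filter_add_card_filter_not
      (s := (fillings B A R).filter fun P => (i₀, j₀) ∈ P) fun P => ∃ i < i₀, (i, j₀) ∈ P,
    Finset.filter_filter, Finset.filter_filter]
  -- By the parent rule, an occupied corner with no point above it is exactly one with a point to
  -- its left.
  have e : ((fillings B A R).filter fun P => (i₀, j₀) ∈ P ∧ ¬ ∃ i < i₀, (i, j₀) ∈ P) =
      (fillings B A R).filter fun P => (i₀, j₀) ∈ P ∧ ∃ j < j₀, (i₀, j) ∈ P := by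
    refine Finset.filter_congr fun P hP => and_congr_right fun hc => ?_
    rcases (mem_fillings.mp hP).parent _ _ hc h0 with ⟨h5, h6⟩ | ⟨h5, h6⟩
    · exact ⟨fun h => absurd h5 h, fun h => absurd h h6⟩
    · exact ⟨fun _ => h5, fun _ => h6⟩
  rw [e]
  omega

end Corner

end Fillings

/-! ### The recurrence for fillings of border words -/

/-- The fillings of the diagram whose border is the word `w`. -/
noncomputable def wordFillings (w : List Bool) : Finset (Finset (ℕ × ℕ)) :=
  fillings (Finset.range (w.count true)) (Finset.range (w.count false)) (BorderCell w)

theorem wordFillings_false_cons (w : List Bool) : wordFillings (false :: w) = ∅ :=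
  fillings_eq_empty_of_col (j := w.count false) (by simp) fun _ h =>
    lt_irrefl _ (h.lt_count_false (w := w))

theorem wordFillings_append_true (w : List Bool) : wordFillings (w ++ [true]) = ∅ :=
  fillings_eq_empty_of_row (i := w.count true) (by simp) fun j =>
    not_borderCell_append_true w j

theorem wordFillings_corner (u v : List Bool) :
    wordFillings (u ++ false :: true :: v) =
      (wordFillings (u ++ true :: false :: v)).filter fun P =>
        (u.count true, v.count false) ∉ P := by
  have hR : BorderCell (u ++ false :: true :: v) = fun i j =>
      BorderCell (u ++ true :: false :: v) i j ∧ (i, j) ≠ (u.count true, v.count false) := by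
    funext i j
    exact propext (borderCell_corner_iff u v i j)
  rw [wordFillings, wordFillings, ← fillings_remove_corner, hR]
  simp

theorem card_wordFillings_delete_true {u v : List Bool} (h : 0 < u.count true) :
    (wordFillings (u ++ false :: v)).card =
      (fillings ((Finset.range ((u ++ true :: false :: v).count true)).erase (u.count true))
        (Finset.range ((u ++ true :: false :: v).count false))
        (BorderCell (u ++ true :: false :: v))).card := by
  rw [wordFillings, ← card_fillings_image (skip_strictMono (u.count true)) strictMono_id
    (by simp [skip, h]) rfl (borderCell_skip_row u v), image_skip_range (by simp),
    Finset.image_id]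
  simp [add_assoc]

theorem card_wordFillings_delete_false {u v : List Bool} (h : 0 < v.count false) :
    (wordFillings (u ++ true :: v)).card =
      (fillings (Finset.range ((u ++ true :: false :: v).count true))
        ((Finset.range ((u ++ true :: false :: v).count false)).erase (v.count false))
        (BorderCell (u ++ true :: false :: v))).card := by
  rw [wordFillings, ← card_fillings_image strictMono_id (skip_strictMono (v.count false))
    rfl (by simp [skip, h]) (borderCell_skip_col u v), image_skip_range (by simp),
    Finset.image_id]
  simp [add_assoc]

theorem fillings_eq_empty_of_zero_notMem {B A : Finset ℕ} {R : ℕ → ℕ → Prop}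
    (h : 0 ∉ B ∨ 0 ∉ A) : fillings B A R = ∅ := by
  refine Finset.eq_empty_of_forall_notMem fun P hP => ?_
  obtain ⟨h1, h2, -⟩ := (mem_fillings.mp hP).cell 0 0 (mem_fillings.mp hP).root
  tauto

theorem wordFillings_append_false_of_count {u : List Bool} (h : u.count true = 0) (v : List Bool) :
    wordFillings (u ++ false :: v) = ∅ := by
  rcases u with _ | ⟨_ | _, u⟩
  · exact wordFillings_false_cons v
  · exact wordFillings_false_cons _
  · simp at h

theorem wordFillings_append_true_of_count {v : List Bool} (h : v.count false = 0) (u : List Bool) :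
    wordFillings (u ++ true :: v) = ∅ := by
  rcases List.eq_nil_or_concat v with rfl | ⟨v, l, rfl⟩
  · exact wordFillings_append_true u
  · cases l
    · simp at h
    · simpa using wordFillings_append_true (u ++ true :: v)

/-- This is the three-way split at the corner, with the deleted row or column read as a deleted
letter. Only the word `true false` is excluded: its corner is the root cell, whose point has no
parent. -/
theorem card_wordFillings {u v : List Bool} (h : u ≠ [] ∨ v ≠ []) :
    (wordFillings (u ++ true :: false :: v)).card =
      (wordFillings (u ++ false :: true :: v)).card + (wordFillings (u ++ false :: v)).card +
        (wordFillings (u ++ true :: v)).card := by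
  -- If the corner is the cell (0, 0) but the word is longer, u starts with `false` or v ends in
  -- `true`, and all four counts vanish.
  by_cases h0 : u.count true = 0 ∧ v.count false = 0
  · obtain ⟨hu, hv⟩ := h0
    have e : wordFillings (u ++ true :: false :: v) = ∅ := by
      rcases u with _ | ⟨_ | _, u⟩
      · rcases List.eq_nil_or_concat v with rfl | ⟨v, l, rfl⟩
        · simp at h
        · cases l
          · simp at hv
          · simpa using wordFillings_append_true (true :: false :: v)
      · exact wordFillings_false_cons _
      · simp at hu
    rw [wordFillings_corner, e, wordFillings_append_false_of_count hu,
      wordFillings_append_true_of_count hv]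
    rfl
  · have key := card_fillings_corner (B := Finset.range ((u ++ true :: false :: v).count true))
      (A := Finset.range ((u ++ true :: false :: v).count false))
      (R := BorderCell (u ++ true :: false :: v)) (i₀ := u.count true) (j₀ := v.count false)
      (by simpa using h0) (by simp) (by simp; omega) (borderCell_corner u v)
      (fun j _ => le_of_borderCell_corner_row) (fun i _ => le_of_borderCell_corner_col)
    -- Deleting row 0 would remove the root, so relabelling does not apply; both sides are then
    -- empty.
    have e1 : (wordFillings (u ++ false :: v)).card = _ :=
      if hu : u.count true = 0 then by
        rw [wordFillings_append_false_of_count hu, ← fillings_eq_empty_of_zero_notMem]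
        left
        rw [hu]
        exact Finset.notMem_erase 0 _
      else card_wordFillings_delete_true (Nat.pos_of_ne_zero hu)
    have e2 : (wordFillings (u ++ true :: v)).card = _ :=
      if hv : v.count false = 0 then by
        rw [wordFillings_append_true_of_count hv, ← fillings_eq_empty_of_zero_notMem]
        right
        rw [hv]
        exact Finset.notMem_erase 0 _
      else card_wordFillings_delete_false (Nat.pos_of_ne_zero hv)
    rw [e1, e2, wordFillings_corner, wordFillings, ← fillings_remove_corner]
    exact key

theorem card_wordFillings_true_false : (wordFillings [true, false]).card = 1 := by
  rw [Finset.card_eq_one]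
  refine ⟨{(0, 0)}, ?_⟩
  ext P
  rw [wordFillings, mem_fillings, Finset.mem_singleton]
  constructor
  · intro h
    ext ⟨i, j⟩
    rw [Finset.mem_singleton]
    constructor
    · intro hij
      have := h.cell i j hij
      simp at this
      simp [this]
    · rintro h'
      exact h' ▸ h.root
  · rintro rfl
    refine ⟨?_, ?_, ?_, ?_, ?_⟩ <;> simp [BorderCell]

/-! ### Tree-like tableaux as fillings of border words -/

namespace TreeLikeTableau

open Classical in
/-- The tree-like tableau given by a filling of the diagram with border `w`. -/
noncomputable def ofFilling (w : List Bool) (P : Finset (ℕ × ℕ)) (h : P ∈ wordFillings w) :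
    TreeLikeTableau :=
  have h' := mem_fillings.mp h
  { shape :=
    { cells := {c ∈ Finset.range (w.count true) ×ˢ Finset.range (w.count false) |
        BorderCell w c.1 c.2}
      isLowerSet := by
        rintro ⟨i, j⟩ ⟨i', j'⟩ ⟨hi, hj⟩ hc
        simp only [Finset.coe_filter, Set.mem_ofPred_eq, Finset.mem_product, Finset.mem_range] at hc ⊢
        have := hc.2.mono hi hj
        exact ⟨⟨this.lt_count_true, this.lt_count_false⟩, this⟩ }
    points := P
    points_subset := by
      rintro ⟨i, j⟩ hij
      obtain ⟨h1, h2, h3⟩ := h'.cell i j hij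
      exact Finset.mem_filter.mpr ⟨Finset.mk_mem_product h1 h2, h3⟩
    root_mem := h'.root
    parent := h'.parent
    row_pointed := fun i hi =>
      h'.row i (Finset.mem_product.mp (Finset.mem_filter.mp hi).1).1
    col_pointed := fun j hj =>
      h'.col j (Finset.mem_product.mp (Finset.mem_filter.mp hj).1).2 }

variable {w : List Bool} {P : Finset (ℕ × ℕ)}

theorem mem_shape_ofFilling (h : P ∈ wordFillings w) {i j : ℕ} :
    (i, j) ∈ (ofFilling w P h).shape ↔ BorderCell w i j := by
  rw [← YoungDiagram.mem_cells]
  simp only [ofFilling, Finset.mem_filter, Finset.mem_product, Finset.mem_range,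
    and_iff_right_iff_imp]
  exact fun h => ⟨h.lt_count_true, h.lt_count_false⟩

theorem size_ofFilling (h : P ∈ wordFillings w) : (ofFilling w P h).size + 1 = w.length := by
  have e := (mem_fillings.mp h).card_add_one
  rw [Finset.card_range, Finset.card_range] at e
  exact e.trans (List.count_true_add_count_false w)

theorem exists_ofFilling (T : TreeLikeTableau) :
    ∃ (w : List Bool) (P : Finset (ℕ × ℕ)) (h : P ∈ wordFillings w), ofFilling w P h = T := by
  obtain ⟨w, h1, h2, h3⟩ := exists_border (T.shape.colLen 0) (T.shape.rowLen 0) T.shape.rowLen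
    (fun _ _ h => T.shape.rowLen_anti _ _ h) le_rfl fun i hi => by
      by_contra h0
      have h4 : (i, 0) ∈ T.shape :=
        YoungDiagram.mem_iff_lt_rowLen.mpr (Nat.pos_of_ne_zero h0)
      exact absurd (YoungDiagram.mem_iff_lt_colLen.mp h4) (by omega)
  have hcell : ∀ i j, BorderCell w i j ↔ (i, j) ∈ T.shape := fun i j =>
    (h3 i j).trans YoungDiagram.mem_iff_lt_rowLen.symm
  have hP : T.points ∈ wordFillings w := by
    rw [wordFillings, mem_fillings, h1, h2]
    refine ⟨fun i j hij => ?_, T.root_mem, T.parent, fun i hi => ?_, fun j hj => ?_⟩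
    · have hc := (hcell i j).mpr (T.points_subset hij)
      exact ⟨Finset.mem_range.mpr (h1 ▸ hc.lt_count_true),
        Finset.mem_range.mpr (h2 ▸ hc.lt_count_false), hc⟩
    · exact T.row_pointed i (YoungDiagram.mem_iff_lt_colLen.mpr (Finset.mem_range.mp hi))
    · exact T.col_pointed j (YoungDiagram.mem_iff_lt_rowLen.mpr (Finset.mem_range.mp hj))
  refine ⟨w, T.points, hP, TreeLikeTableau.ext ?_ rfl⟩
  ext ⟨i, j⟩
  exact (mem_shape_ofFilling hP).trans (hcell i j)

/-- Since every row and column contains a point, the points determine the letter counts, and these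
together with the cells determine the border. -/
theorem eq_of_ofFilling_eq {w' : List Bool} {P' : Finset (ℕ × ℕ)} {h : P ∈ wordFillings w}
    {h' : P' ∈ wordFillings w'} (e : ofFilling w P h = ofFilling w' P' h') : w = w' ∧ P = P' := by
  obtain rfl : P = P' := congrArg points e
  have hcell : ∀ i j, BorderCell w i j ↔ BorderCell w' i j := fun i j => by
    rw [← mem_shape_ofFilling h, ← mem_shape_ofFilling h', e]
  refine ⟨?_, rfl⟩
  rw [wordFillings, mem_fillings] at h h'
  have row : ∀ i, i < w.count true ↔ i < w'.count true := fun i =>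
    ⟨fun hi => by
      obtain ⟨j, hj⟩ := h.row i (Finset.mem_range.mpr hi)
      exact Finset.mem_range.mp (h'.cell i j hj).1,
    fun hi => by
      obtain ⟨j, hj⟩ := h'.row i (Finset.mem_range.mpr hi)
      exact Finset.mem_range.mp (h.cell i j hj).1⟩
  have col : ∀ j, j < w.count false ↔ j < w'.count false := fun j =>
    ⟨fun hj => by
      obtain ⟨i, hi⟩ := h.col j (Finset.mem_range.mpr hj)
      exact Finset.mem_range.mp (h'.cell i j hi).2.1,
    fun hj => by
      obtain ⟨i, hi⟩ := h'.col j (Finset.mem_range.mpr hj)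
      exact Finset.mem_range.mp (h.cell i j hi).2.1⟩
  exact eq_of_borderCell_iff (eq_of_forall_lt_iff row) (eq_of_forall_lt_iff col) hcell

theorem mem_nonOccupiedCorners {T : TreeLikeTableau} {c : ℕ × ℕ} :
    c ∈ T.nonOccupiedCorners ↔ T.shape.IsCorner c ∧ c ∉ T.points := by
  simp only [nonOccupiedCorners, Finset.mem_filter, and_iff_right_iff_imp]
  exact fun h => (YoungDiagram.mem_cells _).mpr h.1.1

/-- Removing a non-occupied corner yields a tableau whose border has the two steps around this
corner exchanged. -/
theorem sum_noc (n : ℕ) :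
    ∑ T ∈ ofSize (n + 1), T.noc = ∑ p ∈ Finset.HasAntidiagonal.antidiagonal n,
      ∑ u ∈ words p.1, ∑ v ∈ words p.2, (wordFillings (u ++ false :: true :: v)).card := by
  have key : ∀ {u v : List Bool} {P}, P ∈ wordFillings (u ++ false :: true :: v) →
      P ∈ wordFillings (u ++ true :: false :: v) ∧ (u.count true, v.count false) ∉ P := by
    intro u v P h
    rw [wordFillings_corner] at h
    exact Finset.mem_filter.mp h
  simp only [noc]
  rw [← Finset.card_sigma]
  simp only [← Finset.card_sigma]
  symm
  refine Finset.card_bij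
    (fun x hx => ⟨ofFilling (x.2.1 ++ true :: false :: x.2.2.1) x.2.2.2
      (key (by simp only [Finset.mem_sigma] at hx; exact hx.2.2.2)).1,
      (x.2.1.count true, x.2.2.1.count false)⟩) ?_ ?_ ?_
  · rintro ⟨⟨a, b⟩, u, v, P⟩ hx
    simp only [Finset.mem_sigma, Finset.HasAntidiagonal.mem_antidiagonal, mem_words] at hx
    obtain ⟨hab, rfl, rfl, hP⟩ := hx
    simp only [Finset.mem_sigma, mem_ofSize, mem_nonOccupiedCorners]
    refine ⟨?_, ⟨?_, ?_, ?_⟩, (key hP).2⟩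
    · have := size_ofFilling (key hP).1
      simp at this
      omega
    · exact (mem_shape_ofFilling _).mpr (borderCell_corner u v)
    · exact fun h => not_borderCell_right u v ((mem_shape_ofFilling _).mp h)
    · exact fun h => not_borderCell_below u v ((mem_shape_ofFilling _).mp h)
  · rintro ⟨⟨a, b⟩, u, v, P⟩ hx ⟨⟨a', b'⟩, u', v', P'⟩ hx' e
    simp only [Finset.mem_sigma, Finset.HasAntidiagonal.mem_antidiagonal, mem_words] at hx hx'
    obtain ⟨hab, rfl, rfl, hP⟩ := hx
    obtain ⟨hab', rfl, rfl, hP'⟩ := hx'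
    simp only [Sigma.mk.injEq, heq_eq_eq, Prod.mk.injEq] at e
    obtain ⟨e1, rfl⟩ := eq_of_ofFilling_eq e.1
    obtain ⟨rfl, rfl⟩ := factor_unique e1 e.2.1
    rfl
  · rintro ⟨T, i, j⟩ hx
    simp only [Finset.mem_sigma, mem_ofSize, mem_nonOccupiedCorners] at hx
    obtain ⟨hs, ⟨h1, h2, h3⟩, h4⟩ := hx
    obtain ⟨w, P, hP, rfl⟩ := exists_ofFilling T
    obtain ⟨u, v, rfl, rfl, rfl⟩ := exists_factor_of_corner ((mem_shape_ofFilling hP).mp h1)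
      (fun h => h2 ((mem_shape_ofFilling hP).mpr h)) fun h => h3 ((mem_shape_ofFilling hP).mpr h)
    have hP' : P ∈ wordFillings (u ++ false :: true :: v) := by
      rw [wordFillings_corner, Finset.mem_filter]
      exact ⟨hP, h4⟩
    refine ⟨⟨(u.length, v.length), u, v, P⟩, ?_, rfl⟩
    simp only [Finset.mem_sigma, Finset.HasAntidiagonal.mem_antidiagonal, mem_words]
    refine ⟨?_, trivial, trivial, hP'⟩
    have := size_ofFilling hP
    simp at this
    omega

end TreeLikeTableau

/-! ### Enumeration -/

/-- Only words starting with `true` and ending in `false` contribute; stripping these two letters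
reduces the sum to G. -/
theorem sum_card_wordFillings (a b : ℕ) :
    ∑ u ∈ words (a + 1), ∑ v ∈ words (b + 1),
      ((wordFillings (u ++ false :: true :: v)).card : ℚ) =
      (a + 1) * (b + 1) * (a + b + 1).factorial := by
  have h := sum_words_append (G := fun w => ((wordFillings (true :: w ++ [false])).card : ℚ))
    (by simp [card_wordFillings_true_false])
    (fun u v => by
      have := card_wordFillings (u := true :: u) (v := v ++ [false]) (by simp)
      simp only [List.cons_append, List.append_assoc] at this ⊢
      exact_mod_cast this)
    (fun v => by
      have := card_wordFillings (u := []) (v := v ++ [false]) (by simp)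
      simp only [List.nil_append, wordFillings_false_cons, Finset.card_empty] at this
      simpa using this)
    (fun v => by
      have := card_wordFillings (u := true :: v) (v := []) (by simp)
      have e := wordFillings_append_true (true :: v ++ [false])
      have e' := wordFillings_append_true (true :: v)
      simp only [List.append_assoc, List.cons_append, List.nil_append] at *
      rw [this, e, e']
      simp) a b
  rw [← h, sum_words_succ]
  refine Finset.sum_congr rfl fun u _ => ?_
  rw [sum_words_succ', sum_words_succ']
  have e : ∀ v, wordFillings (true :: u ++ false :: true :: (v ++ [true])) = ∅ := fun v => by
    simpa using wordFillings_append_true (true :: u ++ false :: true :: v)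
  simp only [List.cons_append] at e
  simp [wordFillings_false_cons, e]

theorem sum_card_wordFillings_zero_left (b : ℕ) :
    ∑ u ∈ words 0, ∑ v ∈ words b, (wordFillings (u ++ false :: true :: v)).card = 0 := by
  simp [words_zero, wordFillings_false_cons]

theorem sum_card_wordFillings_zero_right (a : ℕ) :
    ∑ u ∈ words a, ∑ v ∈ words 0, (wordFillings (u ++ false :: true :: v)).card = 0 := by
  have e : ∀ u, wordFillings (u ++ [false, true]) = ∅ := fun u => by
    simpa using wordFillings_append_true (u ++ [false])
  simp [words_zero, e]

theorem mainTheorem4 :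
    (∀ n : ℕ, 3 ≤ n →
      ((∑ T ∈ TreeLikeTableau.ofSize n, T.noc : ℕ) : ℚ) =
        (Nat.factorial n : ℚ) * (((n : ℚ) - 2) / 6)) ∧
    (∑ T ∈ TreeLikeTableau.ofSize 1, T.noc) = 0 ∧
    (∑ T ∈ TreeLikeTableau.ofSize 2, T.noc) = 0 := by
  refine ⟨fun n hn => ?_, ?_, ?_⟩
  -- In a word of length n + 1 = m + 4, the two outer letters and the two exchanged ones are fixed,
  -- leaving m free letters. The end terms of the antidiagonal vanish because u or v is empty there.
  · obtain ⟨m, rfl⟩ : ∃ m, n = m + 3 := ⟨n - 3, by omega⟩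
    rw [TreeLikeTableau.sum_noc (m + 2), Finset.Nat.sum_antidiagonal_succ,
      Finset.Nat.sum_antidiagonal_succ', sum_card_wordFillings_zero_left,
      sum_card_wordFillings_zero_right, zero_add, zero_add]
    push_cast
    simp only [sum_card_wordFillings]
    have e : ∀ p ∈ Finset.HasAntidiagonal.antidiagonal m,
        ((p.1 : ℚ) + 1) * (p.2 + 1) * (p.1 + p.2 + 1).factorial =
          ((p.1 : ℚ) + 1) * (p.2 + 1) * (m + 1).factorial := fun p hp => by
      rw [Finset.HasAntidiagonal.mem_antidiagonal.mp hp]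
    rw [Finset.sum_congr rfl e, ← Finset.sum_mul, sum_antidiagonal_succ_mul_succ,
      Nat.factorial_succ (m + 2), Nat.factorial_succ (m + 1)]
    push_cast
    ring
  · rw [TreeLikeTableau.sum_noc 0]
    simp [sum_card_wordFillings_zero_left]
  · rw [TreeLikeTableau.sum_noc 1, Finset.Nat.sum_antidiagonal_succ,
      sum_card_wordFillings_zero_left]
    simp [sum_card_wordFillings_zero_right]
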